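/- Let $n=p^m$, where $p$ is an odd prime and $m\ge 1$, and let $T_{4n}=\langle a,b\mid a^{2n}=1,\ a^n=b^2,\ b^{-1}ab=a^{-1}\rangle$ be the dicyclic group of order $4n$. Let $1\le k_1<\dots<k_r\le n-1$ be integers, put $S=\{a^{\pm k_1},\dots,a^{\pm k_r}\}\cup\langle a\rangle b$, and let $r_{\mathrm{odd}}$ be the number of odd integers among $k_1,\dots,k_r$. Let $\Gamma=\mathrm{Cay}(T_{4n},S)$ be the graph with vertex set $T_{4n}$ and edges $\{g,sg\}$ $(g\in T_{4n},\ s\in S)$, let $A$ be its adjacency matrix, and let $H(t)=\exp(\mathrm{i}tA)$ for $t\in\mathbb{R}$. For distinct vertices $x,y$, say that $\Gamma$ admits pretty good fractional revival (PGFR) from $x$ to $y$ if there are a sequence $(t_j)$ of real numbers and complex numbers $\alpha,\beta$ with $|\alpha|^2+|\beta|^2=1$ and $\beta\neq 0$ such that $\lim_{j\to\infty}H(t_j)\mathbf{e}_x=\alpha\mathbf{e}_x+\beta\mathbf{e}_y$. If $\gcd(r_{\mathrm{odd}},p)=1$, then $\Gamma$ admits PGFR. More precisely, for every integer $u$, $\Gamma$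 admits PGFR from $a^u$ to $a^{u+n}$ and from $a^ub$ to $a^{u+n}b$ (hence, as $a^{2n}=1$, in both directions between these vertices). -/

import Mathlib

namespace PGFR

open Filter
open scoped Topology Matrix

/-- The Cayley graph `Cay(G, S)`, with vertex set `G` and edges `{g, s g}` for `g ∈ G`, `s ∈ S`. -/
def cayleyGraph {G : Type*} [Group G] (S : Set G) : SimpleGraph G :=
  SimpleGraph.fromRel fun g h => ∃ s ∈ S, h = s * g

noncomputable instance {G : Type*} [Group G] (S : Set G) : DecidableRel (cayleyGraph S).Adj :=
  Classical.decRel _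

/-- The transition matrix `H(t) = exp(i t A)`, where `A` is the adjacency matrix of `Γ`. -/
noncomputable def transitionMatrix {V : Type*} [Fintype V] [DecidableEq V]
    (Γ : SimpleGraph V) [DecidableRel Γ.Adj] (t : ℝ) : Matrix V V ℂ :=
  NormedSpace.exp ((Complex.I * (t : ℂ)) • Γ.adjMatrix ℂ)

/-- Pretty good fractional revival from `u` to `v`: the vertices are distinct and
`H(t_j) e_u → α e_u + β e_v` along some sequence of real times, with `|α|² + |β|² = 1`.
The case `β = 0` (approximate periodicity, which holds trivially) is excluded. -/
def AdmitsPGFR {V : Type*} [Fintype V] [DecidableEq V]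
    (Γ : SimpleGraph V) [DecidableRel Γ.Adj] (u v : V) : Prop :=
  u ≠ v ∧ ∃ (t : ℕ → ℝ) (α β : ℂ), ‖α‖ ^ 2 + ‖β‖ ^ 2 = 1 ∧ β ≠ 0 ∧
    Tendsto (fun j => transitionMatrix Γ (t j) *ᵥ Pi.single u (1 : ℂ)) atTop
      (𝓝 (α • Pi.single u (1 : ℂ) + β • Pi.single v (1 : ℂ)))

/-- The generator `a` of the dicyclic group
`T_{4n} = ⟨a, b ∣ a^{2n} = 1, a^n = b^2, b⁻¹ a b = a⁻¹⟩`. -/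
def genA (n : ℕ) : QuaternionGroup n := QuaternionGroup.a 1

/-- The generator `b` of the dicyclic group. -/
def genB (n : ℕ) : QuaternionGroup n := QuaternionGroup.xa 0

/-- The connection set `{a^{±k} ∣ k ∈ K} ∪ ⟨a⟩ b`. -/
def connectionSet (n : ℕ) (K : Finset ℕ) : Set (QuaternionGroup n) :=
  {g | ∃ k ∈ K, g = genA n ^ k ∨ g = (genA n ^ k)⁻¹} ∪
    {g | ∃ c ∈ Subgroup.zpowers (genA n), g = c * genB n}

end PGFR

/-! Each coset of `⟨a⟩` carries the circulant graph on `ZMod (2 * n)` with connection set `±K`, and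
the two cosets are completely joined. Hence each vertex state is a sum of eigenvectors coming from
characters `l` of one coset (two of them for `l = 0`), and the state of its `a ^ n` translate is the
same sum with signs `(-1) ^ l`. Revival follows once the phases tend to one value on even indices
and to a different one on odd indices (`admitsPGFR_of_eigenvectors`).

By Kronecker's theorem (`exists_seq_tendsto_of_relations`), target phases are reachable when they
satisfy every integer relation among the eigenvalues. The eigenvalues are integer polynomials `P i`
at a primitive root `w` of order `2 p ^ m`. Since `-w` has order `p ^ m` and `Φ_{p^m}(1) = p`,
sending `w` to `-1` is a reduction modulo `p`, so the phases `P i (-1) / p` satisfy all relations.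
With `r = |K|`, these values are `2r` on even indices and `2r - 4 r_odd` on odd ones modulo `p`,
distinct because `p` is odd and prime to `r_odd`. -/

namespace PGFR

open Filter MeasureTheory
open scoped Topology Matrix

/-! ### Kronecker approximation via closed subgroups of the torus -/

section Kronecker

variable {ι : Type*} [Fintype ι]

/-- The one-parameter subgroup `t ↦ (t μ_i)_i` of the torus. -/
noncomputable def torusLine (μ : ι → ℝ) : ℝ →+ UnitAddTorus ι where
  toFun t i := ((t * μ i : ℝ) : UnitAddCircle)
  map_zero' := by ext i; simp
  map_add' s t := by ext i; simp [add_mul]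

lemma mFourier_torusLine (μ : ι → ℝ) (c : ι → ℤ) (t : ℝ) :
    UnitAddTorus.mFourier c (torusLine μ t) =
      Complex.exp (2 * Real.pi * Complex.I * t * (∑ i, c i * μ i : ℝ)) := by
  simp only [UnitAddTorus.mFourier, ContinuousMap.coe_mk, torusLine, AddMonoidHom.coe_mk,
    ZeroHom.coe_mk, fourier_coe_apply]
  rw [← Complex.exp_sum]
  congr 1
  push_cast
  rw [Finset.mul_sum]
  refine Finset.sum_congr rfl fun i _ => ?_
  ring

lemma mFourier_add_apply (c : ι → ℤ) (x y : UnitAddTorus ι) :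
    UnitAddTorus.mFourier c (x + y) =
      UnitAddTorus.mFourier c x * UnitAddTorus.mFourier c y := by
  simp [UnitAddTorus.mFourier, fourier_apply, Finset.prod_mul_distrib, AddCircle.toCircle_add]

lemma mFourier_eq_toCircle_sum (c : ι → ℤ) (x : UnitAddTorus ι) :
    UnitAddTorus.mFourier c x = (AddCircle.toCircle (∑ i, c i • x i) : ℂ) := by
  have h : ∀ s : Finset ι, ∏ i ∈ s, (fourier (c i) (x i) : ℂ) =
      (AddCircle.toCircle (∑ i ∈ s, c i • x i) : ℂ) := by
    classical
    intro s
    induction s using Finset.induction_on with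
    | empty => simp
    | insert i s hi ih =>
      rw [Finset.prod_insert hi, Finset.sum_insert hi, ih, AddCircle.toCircle_add]
      simp [fourier_apply]
  simpa [UnitAddTorus.mFourier] using h Finset.univ

/-- A point of the torus at which every character that is trivial on the closed subgroup `H`
takes the value `1` lies in `H`. -/
lemma mem_of_mFourier_eq_one (H : AddSubgroup (UnitAddTorus ι))
    (hH : IsClosed (H : Set (UnitAddTorus ι)))
    (x : UnitAddTorus ι)
    (hx : ∀ c : ι → ℤ, (∀ y ∈ H, UnitAddTorus.mFourier c y = 1) →
      UnitAddTorus.mFourier c x = 1) : x ∈ H := by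
  by_contra hxH
  have : CompactSpace H := isCompact_iff_compactSpace.mp hH.isCompact
  let _ : MeasurableSpace H := borel H
  have : BorelSpace H := ⟨rfl⟩
  let ν : Measure H := Measure.addHaar
  have hint : ∀ f : C(H, ℂ), Integrable f ν := fun f =>
    f.continuous.integrable_of_hasCompactSupport (HasCompactSupport.of_compactSpace _)
  let res (z : UnitAddTorus ι) : C(H, UnitAddTorus ι) :=
    ⟨fun h => (h : UnitAddTorus ι) + z, by fun_prop⟩
  -- This functional compares the Haar averages of `f` over the coset `H + x` and over `H`. It kills
  -- all characters, hence everything, yet it separates the two cosets if `x ∉ H`.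
  let D₀ : C(UnitAddTorus ι, ℂ) →ₗ[ℂ] ℂ :=
    { toFun := fun f => ∫ h, (f.comp (res x)) h - (f.comp (res 0)) h ∂ν
      map_add' := fun f g => by
        refine (integral_congr_ae (Eventually.of_forall fun h => ?_)).trans
          (integral_add ((hint (f.comp (res x))).sub (hint (f.comp (res 0))))
            ((hint (g.comp (res x))).sub (hint (g.comp (res 0)))))
        simp only [ContinuousMap.comp_apply, ContinuousMap.add_apply]
        ring
      map_smul' := fun a f => by
        rw [RingHom.id_apply, ← integral_smul]
        refine integral_congr_ae (Eventually.of_forall fun h => ?_)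
        simp only [ContinuousMap.comp_apply, ContinuousMap.smul_apply, smul_sub] }
  let D : C(UnitAddTorus ι, ℂ) →L[ℂ] ℂ := D₀.mkContinuous (2 * ν.real Set.univ) fun f => by
    have := norm_integral_le_of_norm_le_const (μ := ν) (C := ‖f‖ + ‖f‖)
      (f := fun h => (f.comp (res x)) h - (f.comp (res 0)) h)
      (Eventually.of_forall fun h => (norm_sub_le _ _).trans
        (add_le_add (f.norm_coe_le_norm _) (f.norm_coe_le_norm _)))
    calc _ ≤ _ := this
      _ = _ := by ring
  have hD : D = 0 := by
    refine ContinuousLinearMap.ext_on (s := Set.range (UnitAddTorus.mFourier (d := ι))) ?_ ?_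
    · rw [dense_iff_closure_eq, ← Submodule.topologicalClosure_coe,
        UnitAddTorus.span_mFourier_closure_eq_top]
      rfl
    rintro _ ⟨c, rfl⟩
    have h1 : D (UnitAddTorus.mFourier c) =
        (UnitAddTorus.mFourier c x - 1) * ∫ h : H, UnitAddTorus.mFourier c (h : UnitAddTorus ι) ∂ν := by
      rw [← integral_const_mul]
      refine integral_congr_ae (Eventually.of_forall fun h => ?_)
      simp only [ContinuousMap.comp_apply, res, ContinuousMap.coe_mk, mFourier_add_apply, add_zero]
      ring
    rw [h1, zero_apply]
    -- A character trivial on `H` is `1` at `x`; any other integrates to zero over `H` by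
    -- translation invariance.
    by_cases hc : ∀ y ∈ H, UnitAddTorus.mFourier c y = 1
    · rw [hx c hc, sub_self, zero_mul]
    · push Not at hc
      obtain ⟨y, hy, hy1⟩ := hc
      have h2 := integral_add_right_eq_self (μ := ν)
        (fun h : H => UnitAddTorus.mFourier c (h : UnitAddTorus ι)) ⟨y, hy⟩
      simp only [AddSubgroup.coe_add, mFourier_add_apply] at h2
      rw [integral_mul_const] at h2
      have h3 : (∫ h : H, UnitAddTorus.mFourier c (h : UnitAddTorus ι) ∂ν) *
          (UnitAddTorus.mFourier c y - 1) = 0 := by rw [mul_sub, h2, mul_one, sub_self]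
      rw [(mul_eq_zero.mp h3).resolve_right (sub_ne_zero.mpr hy1), mul_zero]
  -- The distance to `H` vanishes on `H` but is positive at `x`.
  let f : C(UnitAddTorus ι, ℂ) :=
    ⟨fun y => (Metric.infDist y (H : Set (UnitAddTorus ι)) : ℂ),
      Complex.continuous_ofReal.comp (Metric.continuous_infDist_pt _)⟩
  have hf : ∫ h : H, Metric.infDist ((h : UnitAddTorus ι) + x) (H : Set (UnitAddTorus ι)) ∂ν = 0 := by
    have h1 : D f = ∫ h : H,
        ((Metric.infDist ((h : UnitAddTorus ι) + x) (H : Set (UnitAddTorus ι)) : ℝ) : ℂ) ∂ν := by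
      refine integral_congr_ae (Eventually.of_forall fun h => ?_)
      simp only [ContinuousMap.comp_apply, res, f, ContinuousMap.coe_mk, add_zero]
      rw [Metric.infDist_zero_of_mem h.2]
      simp
    rw [hD, zero_apply, integral_complex_ofReal] at h1
    exact_mod_cast h1.symm
  have hpos : 0 < ∫ h : H,
      Metric.infDist ((h : UnitAddTorus ι) + x) (H : Set (UnitAddTorus ι)) ∂ν := by
    refine Continuous.integral_pos_of_hasCompactSupport_nonneg_nonzero (x := 0) ?_
      (HasCompactSupport.of_compactSpace _) (fun h => Metric.infDist_nonneg) ?_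
    · exact (Metric.continuous_infDist_pt _).comp (by fun_prop)
    · rw [AddSubgroup.coe_zero, zero_add]
      exact ((hH.notMem_iff_infDist_pos ⟨0, H.zero_mem⟩).mp hxH).ne'
  exact hpos.ne' hf

/-- **Kronecker's approximation theorem**: the phases `t μ_i` approximate `θ_i` modulo `1`
simultaneously as soon as `θ` satisfies every integer relation satisfied by `μ`. -/
theorem exists_seq_tendsto_of_relations (μ : ι → ℝ) (θ : ι → UnitAddCircle)
    (h : ∀ c : ι → ℤ, ∑ i, (c i : ℝ) * μ i = 0 → ∑ i, c i • θ i = 0) :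
    ∃ t : ℕ → ℝ, ∀ i, Tendsto (fun j => ((t j * μ i : ℝ) : UnitAddCircle)) atTop (𝓝 (θ i)) := by
  have hmem : θ ∈ (torusLine μ).range.topologicalClosure := by
    refine mem_of_mFourier_eq_one _ (AddSubgroup.isClosed_topologicalClosure _) _ fun c hc => ?_
    have hrel : ∑ i, (c i : ℝ) * μ i = 0 := by
      by_contra hne
      set s := ∑ i, (c i : ℝ) * μ i with hs
      -- At this time the character takes the value `exp (π i) = -1`.
      have h1 := hc (torusLine μ (1 / (2 * s)))
        (AddSubgroup.le_topologicalClosure _ ⟨_, rfl⟩)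
      rw [mFourier_torusLine, ← hs] at h1
      have hs' : (s : ℂ) ≠ 0 := by exact_mod_cast hne
      have h2 : 2 * (Real.pi : ℂ) * Complex.I * ((1 / (2 * s) : ℝ) : ℂ) * (s : ℂ) =
          Real.pi * Complex.I := by
        push_cast
        field_simp
      rw [h2, Complex.exp_pi_mul_I] at h1
      norm_num at h1
    rw [mFourier_eq_toCircle_sum, h c hrel]
    simp
  obtain ⟨y, hy, hlim⟩ := mem_closure_iff_seq_limit.mp hmem
  choose t ht using hy
  refine ⟨t, fun i => ?_⟩
  have := (continuous_apply i).continuousAt.tendsto.comp hlim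
  refine this.congr fun j => ?_
  rw [Function.comp_apply, ← ht j]
  rfl

end Kronecker

/-! ### From phases of eigenvectors to fractional revival -/

section Exponential

variable {V : Type*} [Fintype V] [DecidableEq V]

lemma exp_smul_mulVec_of_eigenvector (A : Matrix V V ℂ) (z μ : ℂ) (v : V → ℂ)
    (hv : A *ᵥ v = μ • v) : NormedSpace.exp (z • A) *ᵥ v = Complex.exp (z * μ) • v := by
  let _ : NormedRing (Matrix V V ℂ) := Matrix.linftyOpNormedRing
  let _ : NormedAlgebra ℂ (Matrix V V ℂ) := Matrix.linftyOpNormedAlgebra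
  have hpow : ∀ k : ℕ, (z • A) ^ k *ᵥ v = (z * μ) ^ k • v := by
    intro k
    induction k with
    | zero => simp
    | succ k ih =>
      rw [pow_succ, ← Matrix.mulVec_mulVec, Matrix.smul_mulVec, hv, smul_smul,
        Matrix.mulVec_smul, ih, smul_smul, pow_succ']
  have h1 := NormedSpace.exp_series_hasSum_exp' (𝕂 := ℂ) (z • A)
  have h2 : HasSum (fun k : ℕ => ((k.factorial : ℂ)⁻¹ • (z • A) ^ k) *ᵥ v)
      (NormedSpace.exp (z • A) *ᵥ v) :=
    h1.map (Matrix.mulVec.addMonoidHomLeft v) (by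
      change Continuous fun M : Matrix V V ℂ => M *ᵥ v
      fun_prop)
  have h3 := NormedSpace.exp_series_hasSum_exp' (𝕂 := ℂ) (z * μ)
  have h4 := h3.smul_const v
  rw [Complex.exp_eq_exp_ℂ]
  refine h2.unique ?_
  convert h4 using 2 with k
  rw [Matrix.smul_mulVec, hpow, smul_smul, smul_eq_mul]

/-- A decomposition of two vertex states into the same eigenvectors, up to signs, gives pretty good
fractional revival when the phases can be steered towards two distinct values, according to
the sign. -/
theorem admitsPGFR_of_eigenvectors (Γ : SimpleGraph V) [DecidableRel Γ.Adj] {x y : V} (hxy : x ≠ y)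
    {ι : Type*} [Fintype ι] (μ : ι → ℝ) (v : ι → V → ℂ) (s : ι → Prop) [DecidablePred s]
    (hv : ∀ i, Γ.adjMatrix ℂ *ᵥ v i = (μ i : ℂ) • v i)
    (hx : ∑ i, v i = Pi.single x 1) (hy : ∑ i, (if s i then (1 : ℂ) else -1) • v i = Pi.single y 1)
    (θ₀ θ₁ : UnitAddCircle) (hθ : θ₀ ≠ θ₁)
    (hrel : ∀ c : ι → ℤ, ∑ i, (c i : ℝ) * μ i = 0 →
      ∑ i, c i • (if s i then θ₀ else θ₁) = 0) :
    AdmitsPGFR Γ x y := by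
  obtain ⟨t, ht⟩ := exists_seq_tendsto_of_relations μ _ hrel
  set γ₀ := (AddCircle.toCircle θ₀ : ℂ) with hγ₀
  set γ₁ := (AddCircle.toCircle θ₁ : ℂ) with hγ₁
  have hγ : γ₀ ≠ γ₁ := fun h =>
    hθ (AddCircle.injective_toCircle one_ne_zero (Circle.coe_injective h))
  have h0 : ‖γ₀‖ = 1 := Circle.norm_coe _
  have h1 : ‖γ₁‖ = 1 := Circle.norm_coe _
  -- The even and odd parts of the state at `x` are `(e_x ± e_y) / 2`; scaling them by `γ₀` and `γ₁`
  -- gives these coefficients. The factor `2π` converts phases modulo `1` to angles.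
  refine ⟨hxy, fun j => 2 * Real.pi * t j, (γ₀ + γ₁) / 2, (γ₀ - γ₁) / 2, ?_, ?_, ?_⟩
  · have hpar := parallelogram_law_with_norm ℝ γ₀ γ₁
    rw [norm_div, norm_div, Complex.norm_ofNat, h0, h1] at *
    nlinarith
  · exact div_ne_zero (sub_ne_zero.mpr hγ) two_ne_zero
  · have hlim : Tendsto (fun j => ∑ i, (AddCircle.toCircle ((t j * μ i : ℝ) : UnitAddCircle) : ℂ) • v i)
        atTop (𝓝 (∑ i, (if s i then γ₀ else γ₁) • v i)) := by
      refine tendsto_finsetSum _ fun i _ => Tendsto.smul_const ?_ _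
      have hc : Continuous fun z : UnitAddCircle => (AddCircle.toCircle z : ℂ) :=
        continuous_subtype_val.comp AddCircle.continuous_toCircle
      have := (hc.tendsto _).comp (ht i)
      split_ifs at this ⊢ <;> exact this
    have hval : ∑ i, (if s i then γ₀ else γ₁) • v i =
        ((γ₀ + γ₁) / 2) • Pi.single x (1 : ℂ) + ((γ₀ - γ₁) / 2) • Pi.single y (1 : ℂ) := by
      rw [← hx, ← hy, Finset.smul_sum, Finset.smul_sum, ← Finset.sum_add_distrib]
      refine Finset.sum_congr rfl fun i _ => ?_
      rw [smul_smul, ← add_smul]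
      split_ifs <;> congr 1 <;> ring
    rw [← hval]
    refine hlim.congr fun j => ?_
    rw [← hx, Matrix.mulVec_sum]
    refine Finset.sum_congr rfl fun i _ => ?_
    rw [transitionMatrix, exp_smul_mulVec_of_eigenvector _ _ _ _ (hv i),
      AddCircle.toCircle_apply_mk, Circle.coe_exp]
    congr 2
    push_cast
    ring

end Exponential

/-! ### Adjacency in the Cayley graph: two circulants, completely joined -/

section Graph

variable {n : ℕ}

lemma genA_zpow (u : ℤ) : genA n ^ u = QuaternionGroup.a (u : ZMod (2 * n)) := by
  have hnat : ∀ k : ℕ, genA n ^ k = QuaternionGroup.a (k : ZMod (2 * n)) :=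
    QuaternionGroup.a_one_pow
  obtain ⟨k, rfl | rfl⟩ := u.eq_nat_or_neg
  · rw [zpow_natCast, hnat, Int.cast_natCast]
  · rw [zpow_neg, zpow_natCast, hnat, inv_eq_iff_mul_eq_one,
      QuaternionGroup.a_mul_a, ← QuaternionGroup.a_zero]
    simp

lemma genA_zpow_mul_genB (u : ℤ) :
    genA n ^ u * genB n = QuaternionGroup.xa (-(u : ZMod (2 * n))) := by
  rw [genA_zpow, genB, QuaternionGroup.a_mul_xa, zero_sub]

lemma a_mem_connectionSet (K : Finset ℕ) (i : ZMod (2 * n)) :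
    QuaternionGroup.a i ∈ connectionSet n K ↔ ∃ k ∈ K, i = k ∨ i = -k := by
  have hnat : ∀ k : ℕ, genA n ^ k = QuaternionGroup.a (k : ZMod (2 * n)) :=
    QuaternionGroup.a_one_pow
  have hinv : ∀ k : ℕ, (genA n ^ k)⁻¹ = QuaternionGroup.a (-(k : ZMod (2 * n))) := fun k => by
    simpa using genA_zpow (n := n) (-(k : ℤ))
  constructor
  · rintro (⟨k, hk, h⟩ | ⟨c, ⟨z, rfl⟩, h⟩)
    · rw [hinv, hnat, QuaternionGroup.a.injEq, QuaternionGroup.a.injEq] at h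
      exact ⟨k, hk, h⟩
    · simp only [genA_zpow_mul_genB] at h
      cases h
  · rintro ⟨k, hk, h⟩
    refine Or.inl ⟨k, hk, ?_⟩
    rwa [hinv, hnat, QuaternionGroup.a.injEq, QuaternionGroup.a.injEq]

lemma xa_mem_connectionSet (K : Finset ℕ) (i : ZMod (2 * n)) :
    QuaternionGroup.xa i ∈ connectionSet n K := by
  obtain ⟨z, hz⟩ := ZMod.intCast_surjective (-i)
  refine Or.inr ⟨_, ⟨z, rfl⟩, ?_⟩
  simp only [genA_zpow_mul_genB, hz, neg_neg]

lemma cayleyGraph_adj {G : Type*} [Group G] (S : Set G) (g h : G) :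
    (cayleyGraph S).Adj g h ↔ g ≠ h ∧ (h * g⁻¹ ∈ S ∨ g * h⁻¹ ∈ S) := by
  have key : ∀ g h : G, (∃ s ∈ S, h = s * g) ↔ h * g⁻¹ ∈ S := fun g h =>
    ⟨by rintro ⟨s, hs, rfl⟩; simpa using hs, fun hs => ⟨_, hs, by simp⟩⟩
  rw [cayleyGraph, SimpleGraph.fromRel_adj, key, key]

lemma inv_a (i : ZMod (2 * n)) : (QuaternionGroup.a i)⁻¹ = QuaternionGroup.a (-i) := rfl

lemma inv_xa (i : ZMod (2 * n)) :
    (QuaternionGroup.xa i)⁻¹ = QuaternionGroup.xa ((n : ZMod (2 * n)) + i) := rfl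

lemma two_mul_cast_eq_zero : (n : ZMod (2 * n)) + n = 0 := by
  rw [← two_mul]
  exact_mod_cast ZMod.natCast_self (2 * n)

/-- The vertex with index `i` in the coset `⟨a⟩` (for `true`) or `⟨a⟩ b` (for `false`). -/
def vertex : Bool → ZMod (2 * n) → QuaternionGroup n
  | true, i => QuaternionGroup.a i
  | false, i => QuaternionGroup.xa i

lemma vertex_injective (b : Bool) : Function.Injective (vertex (n := n) b) := by
  intro i j h
  cases b <;> simpa [vertex] using h

lemma adj_vertex_not (K : Finset ℕ) (b : Bool) (i j : ZMod (2 * n)) :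
    (cayleyGraph (connectionSet n K)).Adj (vertex b i) (vertex (!b) j) := by
  rw [cayleyGraph_adj]
  cases b <;> simp [vertex, inv_a, inv_xa, xa_mem_connectionSet]

/-- As `0 < k + l < 2n`, the neighbours `i + k` and `i - l` never coincide. -/
lemma natCast_add_natCast_ne_zero {K : Finset ℕ} (hK : ∀ k ∈ K, 1 ≤ k ∧ k ≤ n - 1)
    {k l : ℕ} (hk : k ∈ K) (hl : l ∈ K) :
    (k : ZMod (2 * n)) + l ≠ 0 := by
  have h1 := hK k hk
  have h2 := hK l hl
  intro h
  rw [← Nat.cast_add, ZMod.natCast_eq_zero_iff] at h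
  have := Nat.le_of_dvd (by omega) h
  omega

lemma natCast_ne_zero {K : Finset ℕ} (hK : ∀ k ∈ K, 1 ≤ k ∧ k ≤ n - 1)
    {k : ℕ} (hk : k ∈ K) : (k : ZMod (2 * n)) ≠ 0 := by
  have h1 := hK k hk
  intro h
  rw [ZMod.natCast_eq_zero_iff] at h
  have := Nat.le_of_dvd (by omega) h
  omega

lemma natCast_injOn {K : Finset ℕ} (hK : ∀ k ∈ K, 1 ≤ k ∧ k ≤ n - 1) :
    Set.InjOn (fun k : ℕ => (k : ZMod (2 * n))) K := by
  intro k hk l hl h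
  have h1 := hK k hk
  have h2 := hK l hl
  exact Nat.ModEq.eq_of_lt_of_lt ((ZMod.natCast_eq_natCast_iff _ _ _).mp h) (by omega) (by omega)

lemma adj_vertex_same {K : Finset ℕ} (hK : ∀ k ∈ K, 1 ≤ k ∧ k ≤ n - 1)
    (b : Bool) (i j : ZMod (2 * n)) :
    (cayleyGraph (connectionSet n K)).Adj (vertex b i) (vertex b j) ↔
      ∃ k ∈ K, j = i + k ∨ j = i - k := by
  have hmem : ((vertex b i ≠ vertex b j ∧ (QuaternionGroup.a (j - i) ∈ connectionSet n K ∨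
        QuaternionGroup.a (i - j) ∈ connectionSet n K)) ↔ ∃ k ∈ K, j = i + k ∨ j = i - k) := by
    rw [a_mem_connectionSet, a_mem_connectionSet]
    constructor
    · rintro ⟨-, ⟨k, hk, h | h⟩ | ⟨k, hk, h | h⟩⟩
      · exact ⟨k, hk, Or.inl (by rw [← h]; ring)⟩
      · exact ⟨k, hk, Or.inr (by linear_combination h)⟩
      · exact ⟨k, hk, Or.inr (by rw [← h]; ring)⟩
      · exact ⟨k, hk, Or.inl (by linear_combination -h)⟩
    · rintro ⟨k, hk, h⟩
      refine ⟨fun he => natCast_ne_zero hK hk ?_, Or.inl ⟨k, hk, ?_⟩⟩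
      · have he' := vertex_injective b he
        rcases h with h | h
        · linear_combination -h - he'
        · linear_combination h + he'
      · rcases h with h | h
        · exact Or.inl (by rw [h]; ring)
        · exact Or.inr (by rw [h]; ring)
  rw [cayleyGraph_adj, ← hmem]
  cases b
  -- On `⟨a⟩ b` the quotient of two elements has the opposite difference as exponent, so the two
  -- alternatives are exchanged.
  · have h1 : ∀ i j : ZMod (2 * n), (n : ZMod (2 * n)) + (n + i) - j = i - j := fun i j => by
      linear_combination two_mul_cast_eq_zero (n := n)
    simp only [vertex, inv_xa, QuaternionGroup.xa_mul_xa, h1]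
    rw [or_comm (a := QuaternionGroup.a (i - j) ∈ connectionSet n K)]
  · simp only [vertex, inv_a, QuaternionGroup.a_mul_a, ← sub_eq_add_neg]

/-- Summation over the neighbours of `i` in the circulant graph with connection set `±K`. -/
lemma sum_ite_circulant [NeZero n] {K : Finset ℕ} (hK : ∀ k ∈ K, 1 ≤ k ∧ k ≤ n - 1)
    (F : ZMod (2 * n) → ℂ) (i : ZMod (2 * n))
    [DecidablePred fun j => ∃ k ∈ K, j = i + (k : ZMod (2 * n)) ∨ j = i - k] :
    ∑ j, (if ∃ k ∈ K, j = i + (k : ZMod (2 * n)) ∨ j = i - k then F j else 0) =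
      ∑ k ∈ K, (F (i + k) + F (i - k)) := by
  have hset : (Finset.univ.filter fun j => ∃ k ∈ K, j = i + (k : ZMod (2 * n)) ∨ j = i - k) =
      K.image (fun k : ℕ => i + (k : ZMod (2 * n))) ∪
        K.image (fun k : ℕ => i - (k : ZMod (2 * n))) := by
    ext j
    simp only [Finset.mem_filter, Finset.mem_univ, true_and, Finset.mem_union, Finset.mem_image]
    grind
  rw [← Finset.sum_filter, hset, Finset.sum_union, Finset.sum_image, Finset.sum_image,
    Finset.sum_add_distrib]
  · exact fun k hk l hl h => natCast_injOn hK hk hl (sub_right_injective h)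
  · exact fun k hk l hl h => natCast_injOn hK hk hl (add_right_injective i h)
  · rw [Finset.disjoint_left]
    intro j hj hj'
    obtain ⟨k, hk, rfl⟩ := Finset.mem_image.mp hj
    obtain ⟨l, hl, h⟩ := Finset.mem_image.mp hj'
    exact natCast_add_natCast_ne_zero hK hk hl (by linear_combination -h)

lemma sum_quaternionGroup [NeZero n] (b : Bool) (F : QuaternionGroup n → ℂ) :
    ∑ g, F g = ∑ i, F (vertex b i) + ∑ i, F (vertex (!b) i) := by
  let e : ZMod (2 * n) ⊕ ZMod (2 * n) ≃ QuaternionGroup n :=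
    { toFun := Sum.elim QuaternionGroup.a QuaternionGroup.xa
      invFun := fun g => match g with
        | QuaternionGroup.a i => Sum.inl i
        | QuaternionGroup.xa i => Sum.inr i
      left_inv := by rintro (i | i) <;> rfl
      right_inv := by rintro (i | i) <;> rfl }
  rw [← e.sum_comp, Fintype.sum_sum_type]
  cases b
  · exact add_comm _ _
  · rfl

/-- The function on the group which is `f` on the coset given by `b` and `g` on the other one. -/
def cosetFun (b : Bool) (f g : ZMod (2 * n) → ℂ) : QuaternionGroup n → ℂ
  | QuaternionGroup.a i => bif b then f i else g i
  | QuaternionGroup.xa i => bif b then g i else f i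

@[simp] lemma cosetFun_vertex (b : Bool) (f g : ZMod (2 * n) → ℂ) (i : ZMod (2 * n)) :
    cosetFun b f g (vertex b i) = f i := by
  cases b <;> rfl

@[simp] lemma cosetFun_vertex_not (b : Bool) (f g : ZMod (2 * n) → ℂ) (i : ZMod (2 * n)) :
    cosetFun b f g (vertex (!b) i) = g i := by
  cases b <;> rfl

lemma funext_vertex (b : Bool) {F G : QuaternionGroup n → ℂ}
    (h : ∀ i, F (vertex b i) = G (vertex b i)) (h' : ∀ i, F (vertex (!b) i) = G (vertex (!b) i)) :
    F = G := by
  funext g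
  cases b <;> rcases g with i | i
  exacts [h' i, h i, h i, h' i]

lemma cosetFun_single (b : Bool) (u : ZMod (2 * n)) :
    cosetFun b (Pi.single u 1) 0 = Pi.single (vertex b u) 1 := by
  refine funext_vertex b (fun i => ?_) fun i => ?_
  · simp [Pi.single_apply, (vertex_injective b).eq_iff]
  · have : vertex (!b) i ≠ vertex b u := by cases b <;> simp [vertex]
    simp [this]

lemma adjMatrix_mulVec_vertex [NeZero n] {K : Finset ℕ} (hK : ∀ k ∈ K, 1 ≤ k ∧ k ≤ n - 1)
    (b : Bool) (F : QuaternionGroup n → ℂ) (i : ZMod (2 * n)) :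
    ((cayleyGraph (connectionSet n K)).adjMatrix ℂ *ᵥ F) (vertex b i) =
      ∑ k ∈ K, (F (vertex b (i + k)) + F (vertex b (i - k))) + ∑ j, F (vertex (!b) j) := by
  classical
  have h : ((cayleyGraph (connectionSet n K)).adjMatrix ℂ *ᵥ F) (vertex b i) =
      ∑ g, if (cayleyGraph (connectionSet n K)).Adj (vertex b i) g then F g else 0 := by
    simp [Matrix.mulVec, dotProduct, SimpleGraph.adjMatrix_apply]
  rw [h, sum_quaternionGroup b]
  simp only [adj_vertex_same hK, adj_vertex_not, if_true]
  rw [sum_ite_circulant hK fun j => F (vertex b j)]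

lemma adjMatrix_mulVec_cosetFun [NeZero n] {K : Finset ℕ} (hK : ∀ k ∈ K, 1 ≤ k ∧ k ≤ n - 1)
    (b : Bool) (f g : ZMod (2 * n) → ℂ) :
    (cayleyGraph (connectionSet n K)).adjMatrix ℂ *ᵥ cosetFun b f g =
      cosetFun b (fun i : ZMod (2 * n) => ∑ k ∈ K, (f (i + k) + f (i - k)) + ∑ j, g j)
        (fun i : ZMod (2 * n) => ∑ k ∈ K, (g (i + k) + g (i - k)) + ∑ j, f j) := by
  refine funext_vertex b (fun i => ?_) fun i => ?_
  · simp [adjMatrix_mulVec_vertex hK]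
  · rw [adjMatrix_mulVec_vertex hK, Bool.not_not]
    simp

end Graph

/-! ### Reduction modulo `p` of relations between cyclotomic integers -/

section Reduction

open Polynomial

/-- An integer polynomial vanishing at a primitive root of unity of order `2 p ^ m` takes a value
divisible by `p` at `-1`. -/
lemma prime_dvd_eval_neg_one {p m : ℕ} (hp : p.Prime) (hodd : Odd p) (hm : 1 ≤ m) {w : ℂ}
    (hw : IsPrimitiveRoot w (2 * p ^ m)) (P : ℤ[X]) (hP : aeval w P = 0) :
    (p : ℤ) ∣ P.eval (-1) := by
  have hpos : 0 < p ^ m := pow_pos hp.pos m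
  have hoddn : Odd (p ^ m) := hodd.pow
  have hη : IsPrimitiveRoot (-w) (p ^ m) := by
    have h1 : w ^ (p ^ m) = -1 :=
      (hw.pow (by omega) (mul_comm 2 (p ^ m))).eq_neg_one_of_two_right
    obtain ⟨q, hq⟩ := hoddn
    have h2 : IsPrimitiveRoot (w ^ 2) (p ^ m) := hw.pow (by omega) rfl
    -- With `p ^ m = 2q + 1`, the power `(w ^ 2) ^ (q + 1) = w ^ (p ^ m + 1)` equals `-w`.
    have h3 := h2.pow_of_coprime (q + 1) (by
      rw [hq]
      have : Nat.Coprime (q + 1) (q + (q + 1)) := by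
        rw [Nat.coprime_add_self_right]
        exact (Nat.coprime_self_add_left).mpr (Nat.coprime_one_left q)
      convert this using 1
      ring)
    convert h3 using 1
    rw [← pow_mul, show 2 * (q + 1) = p ^ m + 1 by omega, pow_succ, h1, neg_one_mul]
  have hQ : aeval (-w) (P.comp (-X)) = 0 := by
    rw [aeval_comp]
    simpa using hP
  have hdvd := minpoly.isIntegrallyClosed_dvd (hη.isIntegral hpos) hQ
  rw [← cyclotomic_eq_minpoly hη hpos] at hdvd
  obtain ⟨R, hR⟩ := hdvd
  -- `P(-X)` is a multiple of `Φ_{p^m}`, whose value at `1` is `p`.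
  have heval := congrArg (eval 1) hR
  obtain ⟨k, rfl⟩ : ∃ k, m = k + 1 := ⟨m - 1, by omega⟩
  have : Fact p.Prime := ⟨hp⟩
  rw [eval_mul, eval_one_cyclotomic_prime_pow, eval_comp] at heval
  exact ⟨R.eval 1, by simpa using heval⟩

lemma coe_intCast_div_eq_zero_iff {p : ℕ} (hp : p ≠ 0) (z : ℤ) :
    (((z : ℝ) / p : ℝ) : UnitAddCircle) = 0 ↔ (p : ℤ) ∣ z := by
  have hp' : (p : ℝ) ≠ 0 := by exact_mod_cast hp
  rw [AddCircle.coe_eq_zero_iff]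
  constructor
  · rintro ⟨k, hk⟩
    refine ⟨k, ?_⟩
    rw [zsmul_eq_mul, mul_one, eq_div_iff hp'] at hk
    have : z = k * (p : ℤ) := by exact_mod_cast hk.symm
    rw [this, mul_comm]
  · rintro ⟨k, rfl⟩
    refine ⟨k, ?_⟩
    push_cast
    rw [zsmul_eq_mul]
    field_simp

lemma coe_intCast_div_eq_iff {p : ℕ} (hp : p ≠ 0) (x y : ℤ) :
    (((x : ℝ) / p : ℝ) : UnitAddCircle) = (((y : ℝ) / p : ℝ) : UnitAddCircle) ↔
      (p : ℤ) ∣ x - y := by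
  rw [← coe_intCast_div_eq_zero_iff hp, ← sub_eq_zero, ← AddCircle.coe_sub]
  push_cast
  rw [sub_div]

/-- Integer relations between values of integer polynomials at a primitive root of unity of order
`2 p ^ m` are inherited, modulo `p`, by the values at `-1`. -/
lemma sum_zsmul_eval_neg_one_eq_zero {p m : ℕ} (hp : p.Prime) (hodd : Odd p) (hm : 1 ≤ m) {w : ℂ}
    (hw : IsPrimitiveRoot w (2 * p ^ m)) {ι : Type*} [Fintype ι] (P : ι → ℤ[X]) (μ : ι → ℝ)
    (hμ : ∀ i, aeval w (P i) = (μ i : ℂ)) (c : ι → ℤ) (hc : ∑ i, (c i : ℝ) * μ i = 0) :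
    ∑ i, c i • ((((P i).eval (-1) : ℤ) / p : ℝ) : UnitAddCircle) = 0 := by
  have h1 : aeval w (∑ i, c i • P i) = 0 := by
    rw [map_sum, ← Complex.ofReal_zero, ← hc, Complex.ofReal_sum]
    refine Finset.sum_congr rfl fun i _ => ?_
    rw [map_zsmul, hμ, zsmul_eq_mul, Complex.ofReal_mul, Complex.ofReal_intCast]
  have h2 := prime_dvd_eval_neg_one hp hodd hm hw _ h1
  rw [eval_finsetSum, ← coe_intCast_div_eq_zero_iff hp.ne_zero] at h2
  rw [← h2]
  push_cast
  rw [Finset.sum_div]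
  change _ = (QuotientAddGroup.mk' _ : ℝ →+ UnitAddCircle) _
  rw [map_sum]
  refine Finset.sum_congr rfl fun i _ => ?_
  rw [eval_smul]
  change c i • (QuotientAddGroup.mk' _ : ℝ →+ UnitAddCircle) _ = _
  rw [← map_zsmul]
  congr 1
  push_cast [zsmul_eq_mul, smul_eq_mul]
  ring

end Reduction

/-! ### Eigenvectors, eigenvalues and their residues modulo `p` -/

section Spectrum

open Polynomial

variable {n : ℕ} [NeZero n]

/-- The eigenvalue of the circulant graph with connection set `±K` at the `l`-th character. -/
noncomputable def circulantEigenvalue (K : Finset ℕ) (l : ZMod (2 * n)) : ℝ :=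
  ∑ k ∈ K, 2 * (ZMod.stdAddChar (l * (k : ZMod (2 * n)))).re

/-- The component of the delta function at `u` along the `l`-th character. -/
noncomputable def charComponent (u l : ZMod (2 * n)) (j : ZMod (2 * n)) : ℂ :=
  ((2 * n : ℕ) : ℂ)⁻¹ * ZMod.stdAddChar (l * (j - u))

lemma stdAddChar_add_neg (x : ZMod (2 * n)) :
    (ZMod.stdAddChar x : ℂ) + ZMod.stdAddChar (-x) =
      ((2 * (ZMod.stdAddChar x : ℂ).re : ℝ) : ℂ) := by
  rw [AddChar.map_neg_eq_conj, Complex.add_conj]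

lemma sum_charComponent_add_sub (K : Finset ℕ) (u l i : ZMod (2 * n)) :
    ∑ k ∈ K, (charComponent u l (i + k) + charComponent u l (i - k)) =
      circulantEigenvalue K l * charComponent u l i := by
  rw [circulantEigenvalue, Complex.ofReal_sum, Finset.sum_mul]
  refine Finset.sum_congr rfl fun k _ => ?_
  rw [← stdAddChar_add_neg, charComponent, charComponent, charComponent,
    show l * (i + k - u) = l * k + l * (i - u) by ring,
    show l * (i - k - u) = -(l * k) + l * (i - u) by ring,
    AddChar.map_add_eq_mul, AddChar.map_add_eq_mul]
  ring

/-- This makes the join between the cosets invisible to nontrivial characters. -/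
lemma sum_charComponent_eq_zero (u : ZMod (2 * n)) {l : ZMod (2 * n)} (hl : l ≠ 0) :
    ∑ j, charComponent u l j = 0 := by
  have h := AddChar.sum_mulShift l (ZMod.isPrimitive_stdAddChar (2 * n))
  rw [if_neg hl, Nat.cast_zero] at h
  simp only [charComponent]
  rw [← Finset.mul_sum, ← Equiv.sum_comp (Equiv.addRight u)]
  simp only [Equiv.coe_addRight, add_sub_cancel_right, mul_comm l]
  rw [h, mul_zero]

lemma sum_stdAddChar_mul_charComponent (u d j : ZMod (2 * n)) :
    ∑ l, ZMod.stdAddChar (l * d) * charComponent u l j =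
      (Pi.single (u - d) (1 : ℂ) : ZMod (2 * n) → ℂ) j := by
  have h := AddChar.sum_mulShift (d + (j - u)) (ZMod.isPrimitive_stdAddChar (2 * n))
  have h2 : ∑ l, ZMod.stdAddChar (l * d) * charComponent u l j =
      ((2 * n : ℕ) : ℂ)⁻¹ * ∑ l : ZMod (2 * n), ZMod.stdAddChar (l * (d + (j - u))) := by
    rw [Finset.mul_sum]
    refine Finset.sum_congr rfl fun l _ => ?_
    rw [charComponent, mul_add l, AddChar.map_add_eq_mul]
    ring
  rw [h2, h, ZMod.card, Pi.single_apply]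
  have hiff : d + (j - u) = 0 ↔ j = u - d := by
    constructor <;> intro h
    · linear_combination h
    · linear_combination h
  have hne : ((2 * n : ℕ) : ℂ) ≠ 0 := by exact_mod_cast NeZero.ne (2 * n)
  simp only [hiff]
  split_ifs
  · exact inv_mul_cancel₀ hne
  · simp

lemma natCast_half_ne_zero : (n : ZMod (2 * n)) ≠ 0 := by
  have hn := NeZero.pos n
  intro h
  rw [ZMod.natCast_eq_zero_iff] at h
  have := Nat.le_of_dvd hn h
  omega

lemma stdAddChar_mul_half (l : ZMod (2 * n)) :
    ZMod.stdAddChar (l * (n : ZMod (2 * n))) = if Even l.val then (1 : ℂ) else -1 := by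
  have hsq : (ZMod.stdAddChar (n : ZMod (2 * n)) : ℂ) * ZMod.stdAddChar (n : ZMod (2 * n)) = 1 := by
    rw [← AddChar.map_add_eq_mul, two_mul_cast_eq_zero, AddChar.map_zero_eq_one]
  have hne : (ZMod.stdAddChar (n : ZMod (2 * n)) : ℂ) ≠ 1 := by
    rw [← AddChar.map_zero_eq_one (ZMod.stdAddChar (N := 2 * n))]
    exact fun h => natCast_half_ne_zero (ZMod.injective_stdAddChar h)
  have hneg := (mul_self_eq_one_iff.mp hsq).resolve_left hne
  have hl : l * (n : ZMod (2 * n)) = l.val • (n : ZMod (2 * n)) := by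
    rw [nsmul_eq_mul, ZMod.natCast_zmod_val]
  rw [hl, AddChar.map_nsmul_eq_pow, hneg]
  split_ifs with h
  · exact h.neg_one_pow
  · exact (Nat.not_even_iff_odd.mp h).neg_one_pow

/-- The eigenvalues of the Cayley graph which occur in the decomposition of a vertex state. -/
noncomputable def eigenvalue (K : Finset ℕ) : Option (ZMod (2 * n)) → ℝ
  | none => 2 * K.card - 2 * n
  | some l => if l = 0 then 2 * K.card + 2 * n else circulantEigenvalue K l

/-- The components of the vertex state at `vertex b u` along the eigenspaces. -/
noncomputable def eigenvector (b : Bool) (u : ZMod (2 * n)) :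
    Option (ZMod (2 * n)) → QuaternionGroup n → ℂ
  | none => cosetFun b (fun _ => ((4 * n : ℕ) : ℂ)⁻¹) (fun _ => -((4 * n : ℕ) : ℂ)⁻¹)
  | some l => if l = 0 then cosetFun b (fun _ => ((4 * n : ℕ) : ℂ)⁻¹) (fun _ => ((4 * n : ℕ) : ℂ)⁻¹)
      else cosetFun b (charComponent u l) 0

/-- The indices of the eigenvectors which `a ^ n` fixes; it negates the other ones. -/
def IsEvenIndex : Option (ZMod (2 * n)) → Prop
  | none => True
  | some l => Even l.val

instance : DecidablePred (IsEvenIndex (n := n))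
  | none => inferInstanceAs (Decidable True)
  | some l => inferInstanceAs (Decidable (Even l.val))

lemma adjMatrix_mulVec_eigenvector {K : Finset ℕ} (hK : ∀ k ∈ K, 1 ≤ k ∧ k ≤ n - 1) (b : Bool)
    (u : ZMod (2 * n)) (i : Option (ZMod (2 * n))) :
    (cayleyGraph (connectionSet n K)).adjMatrix ℂ *ᵥ eigenvector b u i =
      (eigenvalue K i : ℂ) • eigenvector b u i := by
  rcases i with _ | l
  · rw [eigenvector, adjMatrix_mulVec_cosetFun hK, eigenvalue]
    refine funext_vertex b (fun i => ?_) fun i => ?_ <;>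
    · simp [ZMod.card]
      ring
  · by_cases hl : l = 0
    · rw [eigenvector, eigenvalue, if_pos hl, if_pos hl, adjMatrix_mulVec_cosetFun hK]
      refine funext_vertex b (fun i => ?_) fun i => ?_ <;>
      · simp [ZMod.card]
        ring
    · rw [eigenvector, eigenvalue, if_neg hl, if_neg hl, adjMatrix_mulVec_cosetFun hK]
      refine funext_vertex b (fun i => ?_) fun i => ?_
      · simp [sum_charComponent_add_sub]
      · simp [sum_charComponent_eq_zero u hl]

/-- The constant function on a single coset is not an eigenvector; it splits into a symmetric and an
antisymmetric part, indexed by `some 0` and `none`. -/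
lemma eigenvector_some (b : Bool) (u l : ZMod (2 * n)) :
    eigenvector b u (some l) =
      cosetFun b (charComponent u l) 0 - if l = 0 then eigenvector b u none else 0 := by
  by_cases hl : l = 0
  · subst hl
    have hn : (n : ℂ) ≠ 0 := by exact_mod_cast NeZero.ne n
    simp only [eigenvector, if_true]
    refine funext_vertex b (fun i => ?_) fun i => ?_
    · simp [charComponent]
      field_simp
      norm_num
    · simp
  · simp [eigenvector, hl]

/-- Fourier inversion, used with `d = 0` for the initial vertex and `d = n` for the target. -/
lemma sum_smul_eigenvector (b : Bool) (u : ZMod (2 * n)) (σ : Option (ZMod (2 * n)) → ℂ)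
    (d : ZMod (2 * n)) (h0 : σ none = 1) (hσ : ∀ l, σ (some l) = ZMod.stdAddChar (l * d)) :
    ∑ i, σ i • eigenvector b u i = Pi.single (vertex b (u - d)) 1 := by
  have h1 : ∑ l, σ (some l) • eigenvector b u (some l) =
      ∑ l, σ (some l) • cosetFun b (charComponent u l) 0 - eigenvector b u none := by
    simp only [eigenvector_some, smul_sub, Finset.sum_sub_distrib, smul_ite, smul_zero,
      Finset.sum_ite_eq', Finset.mem_univ, if_true, hσ, zero_mul, AddChar.map_zero_eq_one, one_smul]
  rw [Fintype.sum_option, h1, h0, one_smul, add_sub_cancel, ← cosetFun_single]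
  refine funext_vertex b (fun i => ?_) fun i => ?_
  · simp only [Finset.sum_apply, Pi.smul_apply, cosetFun_vertex, hσ, smul_eq_mul]
    exact sum_stdAddChar_mul_charComponent u d i
  · simp

/-- An integer polynomial whose value at `exp (π i / n)` is `eigenvalue K i`. -/
noncomputable def eigenvaluePoly (K : Finset ℕ) : Option (ZMod (2 * n)) → ℤ[X]
  | none => C (2 * K.card - 2 * n : ℤ)
  | some l => if l = 0 then C (2 * K.card + 2 * n : ℤ)
      else ∑ k ∈ K, (X ^ (l.val * k) + X ^ ((2 * n - 1) * (l.val * k)))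

lemma isPrimitiveRoot_stdAddChar_one :
    IsPrimitiveRoot (ZMod.stdAddChar (1 : ZMod (2 * n)) : ℂ) (2 * n) := by
  have h := Complex.isPrimitiveRoot_exp (2 * n) (NeZero.ne _)
  convert h using 1
  simpa using ZMod.stdAddChar_coe (N := 2 * n) 1

lemma aeval_eigenvaluePoly (K : Finset ℕ) (i : Option (ZMod (2 * n))) :
    aeval (ZMod.stdAddChar (1 : ZMod (2 * n)) : ℂ) (eigenvaluePoly K i) = (eigenvalue K i : ℂ) := by
  rcases i with _ | l
  · rw [eigenvaluePoly, eigenvalue, aeval_C]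
    simp
  · by_cases hl : l = 0
    · rw [eigenvaluePoly, eigenvalue, if_pos hl, if_pos hl, aeval_C]
      simp
    · rw [eigenvaluePoly, eigenvalue, if_neg hl, if_neg hl, circulantEigenvalue,
        Complex.ofReal_sum, map_sum]
      refine Finset.sum_congr rfl fun k _ => ?_
      have hpos : 1 ≤ 2 * n := NeZero.pos (2 * n)
      have hneg : ((2 * n - 1 : ℕ) : ZMod (2 * n)) = -1 := by
        rw [Nat.cast_sub hpos, ZMod.natCast_self, Nat.cast_one, zero_sub]
      rw [← stdAddChar_add_neg, map_add, map_pow, map_pow, aeval_X, ← AddChar.map_nsmul_eq_pow,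
        ← AddChar.map_nsmul_eq_pow, nsmul_one, nsmul_one, Nat.cast_mul (2 * n - 1), hneg,
        Nat.cast_mul, ZMod.natCast_zmod_val, neg_one_mul]

lemma sum_neg_one_pow (K : Finset ℕ) :
    ∑ k ∈ K, (-1 : ℤ) ^ k = K.card - 2 * (K.filter fun k => Odd k).card := by
  have h : ∀ k ∈ K, (-1 : ℤ) ^ k = 1 - 2 * (if Odd k then 1 else 0) := by
    intro k _
    split_ifs with hk
    · rw [hk.neg_one_pow]; norm_num
    · rw [(Nat.not_odd_iff_even.mp hk).neg_one_pow]; norm_num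
  rw [Finset.sum_congr rfl h, Finset.sum_sub_distrib, ← Finset.mul_sum]
  simp

lemma dvd_eval_eigenvaluePoly_sub {p : ℕ} (hpn : p ∣ n) (K : Finset ℕ)
    (i : Option (ZMod (2 * n))) :
    (p : ℤ) ∣ (if IsEvenIndex i then (2 * K.card : ℤ)
      else 2 * K.card - 4 * (K.filter fun k => Odd k).card) - (eigenvaluePoly K i).eval (-1) := by
  have hpn' : (p : ℤ) ∣ 2 * n := (Int.natCast_dvd_natCast.mpr hpn).mul_left 2
  rcases i with _ | l
  · simpa [IsEvenIndex, eigenvaluePoly] using hpn'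
  · by_cases hl : l = 0
    · simpa [IsEvenIndex, eigenvaluePoly, hl] using hpn'
    -- The exponent `2 * n - 1` stands for `-1` modulo `2 * n`; being odd, it makes both monomials
    -- agree at `-1`.
    · have hodd : Odd (2 * n - 1) := by
        have := NeZero.pos n
        exact ⟨n - 1, by omega⟩
      have heval : (eigenvaluePoly K (some l)).eval (-1) =
          2 * ∑ k ∈ K, ((-1 : ℤ) ^ l.val) ^ k := by
        rw [eigenvaluePoly, if_neg hl, eval_finsetSum, Finset.mul_sum]
        refine Finset.sum_congr rfl fun k _ => ?_
        rw [eval_add, eval_pow, eval_pow, eval_X, pow_mul _ (2 * n - 1), hodd.neg_one_pow,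
          ← two_mul, pow_mul]
      rw [heval]
      by_cases he : Even l.val
      · simp [IsEvenIndex, he, he.neg_one_pow]
      · rw [(Nat.not_even_iff_odd.mp he).neg_one_pow, sum_neg_one_pow]
        simp only [IsEvenIndex, he, if_false]
        ring_nf
        simp

theorem admitsPGFR_vertex {p m : ℕ} (hp : p.Prime) (hodd : Odd p) (hm : 1 ≤ m) (hn : n = p ^ m)
    {K : Finset ℕ} (hK : ∀ k ∈ K, 1 ≤ k ∧ k ≤ n - 1)
    (hgcd : Nat.gcd (K.filter fun k => Odd k).card p = 1) (b : Bool) (u : ZMod (2 * n)) :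
    AdmitsPGFR (cayleyGraph (connectionSet n K)) (vertex b u) (vertex b (u - n)) := by
  have hpn : p ∣ n := hn ▸ dvd_pow_self p (by omega)
  have hw := isPrimitiveRoot_stdAddChar_one (n := n)
  have hw' : IsPrimitiveRoot (ZMod.stdAddChar (1 : ZMod (2 * n)) : ℂ) (2 * p ^ m) := hn ▸ hw
  refine admitsPGFR_of_eigenvectors (cayleyGraph (connectionSet n K)) ?_ (eigenvalue K)
    (eigenvector b u) IsEvenIndex (adjMatrix_mulVec_eigenvector hK b u) ?_ ?_
    (((2 * K.card : ℤ) / p : ℝ) : UnitAddCircle)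
    (((2 * K.card - 4 * (K.filter fun k => Odd k).card : ℤ) / p : ℝ) : UnitAddCircle) ?_ ?_
  · intro h
    have h' := vertex_injective b h
    exact natCast_half_ne_zero (n := n) (by linear_combination h')
  · simpa using sum_smul_eigenvector b u (fun _ => 1) 0 rfl (by simp)
  · exact sum_smul_eigenvector b u _ n (by simp [IsEvenIndex])
      fun l => (stdAddChar_mul_half l).symm
  · rw [Ne, coe_intCast_div_eq_iff hp.ne_zero, sub_sub_cancel]
    intro h
    have h' : p ∣ 4 * (K.filter fun k => Odd k).card := by exact_mod_cast h
    have hcop : Nat.Coprime p 4 := by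
      have : Nat.Coprime p (2 ^ 2) := (Nat.coprime_two_right.mpr hodd).pow_right 2
      simpa using this
    have h1 := Nat.dvd_gcd (hcop.dvd_of_dvd_mul_left h') dvd_rfl
    rw [hgcd] at h1
    exact hp.one_lt.ne' (Nat.dvd_one.mp h1)
  · intro c hc
    rw [← sum_zsmul_eval_neg_one_eq_zero hp hodd hm hw' (eigenvaluePoly K) (eigenvalue K)
      (aeval_eigenvaluePoly K) c hc]
    refine Finset.sum_congr rfl fun i _ => ?_
    congr 1
    rw [← (coe_intCast_div_eq_iff hp.ne_zero _ _).mpr (dvd_eval_eigenvaluePoly_sub hpn K i)]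
    split_ifs <;> rfl

end Spectrum

end PGFR

theorem mainTheorem2 (p m n : ℕ) [NeZero n] (hp : p.Prime) (hodd : Odd p) (hm : 1 ≤ m)
    (hn : n = p ^ m) (K : Finset ℕ) (hK : ∀ k ∈ K, 1 ≤ k ∧ k ≤ n - 1)
    (hgcd : Nat.gcd (K.filter fun k => Odd k).card p = 1) :
    ∀ u : ℤ,
      PGFR.AdmitsPGFR (PGFR.cayleyGraph (PGFR.connectionSet n K))
        (PGFR.genA n ^ u) (PGFR.genA n ^ (u + n)) ∧
      PGFR.AdmitsPGFR (PGFR.cayleyGraph (PGFR.connectionSet n K))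
        (PGFR.genA n ^ u * PGFR.genB n) (PGFR.genA n ^ (u + n) * PGFR.genB n) := by
  intro u
  have hA := PGFR.admitsPGFR_vertex hp hodd hm hn hK hgcd true (u : ZMod (2 * n))
  -- The element `a ^ u * b` has index `-u` in its coset.
  have hB := PGFR.admitsPGFR_vertex hp hodd hm hn hK hgcd false (-(u : ZMod (2 * n)))
  have h1 : (u : ZMod (2 * n)) - n = ((u + n : ℤ) : ZMod (2 * n)) := by
    push_cast
    linear_combination -PGFR.two_mul_cast_eq_zero (n := n)
  have h2 : -(u : ZMod (2 * n)) - n = -((u + n : ℤ) : ZMod (2 * n)) := by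
    push_cast
    ring
  rw [h1] at hA
  rw [h2] at hB
  rw [PGFR.genA_zpow_mul_genB, PGFR.genA_zpow_mul_genB, PGFR.genA_zpow, PGFR.genA_zpow]
  exact ⟨hA, hB⟩
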